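/- Let $N$ and $M$ be dual finite-dimensional real vector spaces with pairing $(u,v)\mapsto u\cdot v$. A polyhedral cone is a set $\mathbb R_{\ge}v_1+\dots+\mathbb R_{\ge}v_k$; its dual is $\sigma^\vee=\{u : u\cdot v\ge 0\ \forall v\in\sigma\}$, its faces are the sets $\{v\in\sigma : u\cdot v=0\}$ with $u\in\sigma^\vee$, and its relative interior is the complement in $\sigma$ of its proper faces. A fan $\Sigma$ in $N$ is a finite non-empty collection of polyhedral cones in $N$ such that every face of a cone of $\Sigma$ is in $\Sigma$ and the intersection of any two cones of $\Sigma$ is a face of both; it is complete if every point of $N$ lies in some cone of $\Sigma$. For $\sigma\in\Sigma$ let $V_\sigma=\mathrm{Hom}_c(\sigma^\vee,\mathbb R_{\ge})$ be the set of monoid homomorphisms from $(\sigma^\vee,+)$ to $(\mathbb R_{\ge},\cdot)$ that are continuous on the relative interior of each face of $\sigma^\vee$, with the topology of pointwise convergence. If $\tau$ is a face of $\sigma$, restriction to $\sigma^\vee\subset\tau^\vee$ gives an inclusion $V_\tau\hookrightarrow V_\sigma$. The irrational toric variety $Y_\Sigma$ is the topological space obtained by gluing the $V_\sigma$, $\sigma\in\Sigma$,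 along these inclusions. Theorem. For every fan $\Sigma\subset N$, the irrational toric variety $Y_\Sigma$ is a compact topological space if and only if $\Sigma$ is complete. -/

import Mathlib

open scoped NNReal

namespace IrrationalToric

variable {E F : Type*} [AddCommGroup E] [Module ℝ E] [AddCommGroup F] [Module ℝ F]

/-- Let `E` and `F` be vector spaces paired by `p`. A face of a cone `σ ⊆ E` is a subset of the form
`{v ∈ σ | p v u = 0}` for some `u` in the dual cone of `σ`. -/
def IsFace (p : E →ₗ[ℝ] F →ₗ[ℝ] ℝ) (τ σ : PointedCone ℝ E) : Prop :=
  ∃ u ∈ PointedCone.dual p (σ : Set E), (τ : Set E) = {v | v ∈ σ ∧ p v u = 0}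

/-- The relative interior of a cone: the complement in it of its proper faces. -/
def relInterior (p : E →ₗ[ℝ] F →ₗ[ℝ] ℝ) (σ : PointedCone ℝ E) : Set E :=
  {v | v ∈ σ ∧ ∀ τ : PointedCone ℝ E, IsFace p τ σ → τ ≠ σ → v ∉ τ}

/-- `HomC p C` is the set of monoid homomorphisms from the additive monoid `C` to the
multiplicative monoid of nonnegative real numbers that are continuous on the relative interior of
each face of `C`. -/
@[ext]
structure HomC (p : E →ₗ[ℝ] F →ₗ[ℝ] ℝ) [TopologicalSpace E] (C : PointedCone ℝ E) where
  toFun : C → ℝ≥0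
  map_zero : toFun 0 = 1
  map_add : ∀ u w : C, toFun (u + w) = toFun u * toFun w
  continuousOn : ∀ G : PointedCone ℝ E, IsFace p G C →
    ContinuousOn toFun {u : C | (u : E) ∈ relInterior p G}

/-- The weakest topology such that evaluation at every point of `C` is continuous. -/
instance (p : E →ₗ[ℝ] F →ₗ[ℝ] ℝ) [TopologicalSpace E] (C : PointedCone ℝ E) :
    TopologicalSpace (HomC p C) :=
  TopologicalSpace.induced HomC.toFun inferInstance

variable {N M : Type*} [AddCommGroup N] [Module ℝ N] [AddCommGroup M] [Module ℝ M]

/-- A fan in `N` (where `M` is the dual space, with pairing `p`): a finite nonempty collection of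
polyhedral (that is, finitely generated) cones, closed under taking faces, any two of which
intersect in a common face. -/
structure Fan (p : N →ₗ[ℝ] M →ₗ[ℝ] ℝ) where
  cones : Set (PointedCone ℝ N)
  finite : cones.Finite
  nonempty : cones.Nonempty
  polyhedral : ∀ σ ∈ cones, σ.FG
  face_mem : ∀ σ ∈ cones, ∀ τ : PointedCone ℝ N, IsFace p τ σ → τ ∈ cones
  inter_face : ∀ σ ∈ cones, ∀ τ ∈ cones, IsFace p (σ ⊓ τ) σ ∧ IsFace p (σ ⊓ τ) τ

/-- A fan is complete if every point of `N` lies in some cone of the fan. -/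
def Fan.IsComplete {p : N →ₗ[ℝ] M →ₗ[ℝ] ℝ} (S : Fan p) : Prop :=
  ∀ v : N, ∃ σ ∈ S.cones, v ∈ σ

/-- The irrational affine toric variety `V_σ = Hom_c(σ^∨, ℝ≥0)` of a cone `σ` in `N`. Faces of
the dual cone `σ^∨ ⊆ M` are cut out by elements of `N`, through the flipped pairing. -/
abbrev AffineVariety (p : N →ₗ[ℝ] M →ₗ[ℝ] ℝ) [TopologicalSpace M] (σ : PointedCone ℝ N) :
    Type _ :=
  HomC p.flip (PointedCone.dual p (σ : Set N))

/-- `Restricts φ ψ` says that `ψ ∈ V_σ` is the image of `φ ∈ V_τ` under the inclusion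
`V_τ → V_σ` for a face `τ` of `σ`, namely the restriction of `φ : τ^∨ → ℝ≥0` to `σ^∨ ⊆ τ^∨`. -/
def Restricts {p : N →ₗ[ℝ] M →ₗ[ℝ] ℝ} [TopologicalSpace M] {τ σ : PointedCone ℝ N}
    (φ : AffineVariety p τ) (ψ : AffineVariety p σ) : Prop :=
  ∀ (u : M) (hσ : u ∈ PointedCone.dual p (σ : Set N)) (hτ : u ∈ PointedCone.dual p (τ : Set N)),
    ψ.toFun ⟨u, hσ⟩ = φ.toFun ⟨u, hτ⟩

/-- The gluing relation on the disjoint union of the `V_σ`: a point of `V_τ` is glued to its image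
in `V_σ` whenever `τ` is a face of `σ`. -/
def Fan.Glue {p : N →ₗ[ℝ] M →ₗ[ℝ] ℝ} [TopologicalSpace M] (S : Fan p)
    (x y : Σ σ : S.cones, AffineVariety p σ.1) : Prop :=
  IsFace p x.1.1 y.1.1 ∧ Restricts x.2 y.2

/-- The irrational toric variety `Y_Σ` of a fan: the disjoint union of the `V_σ`, for `σ` a cone
of the fan, modulo the equivalence relation generated by the gluing relation. It carries the
quotient topology. -/
def Fan.ToricVariety {p : N →ₗ[ℝ] M →ₗ[ℝ] ℝ} [TopologicalSpace M] (S : Fan p) : Type _ :=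
  Quot S.Glue

instance {p : N →ₗ[ℝ] M →ₗ[ℝ] ℝ} [TopologicalSpace M] (S : Fan p) :
    TopologicalSpace S.ToricVariety :=
  inferInstanceAs (TopologicalSpace (Quot S.Glue))

end IrrationalToric

/-!
Write `exp(-v)` for the homomorphism `u ↦ exp(-⟨v, u⟩)`. The proof rests on an explicit description
of the points of `V_σ`: each of them is, for some `w ∈ σ` and `v ∈ N`, the function equal to
`exp(-v)` on the face `w = 0` of the dual cone and to zero off it (`exists_eq_faceExp`). Indeed the
support of a homomorphism `φ` is a face (`exists_support_eq`), and on it `log φ` is additive. It is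
also bounded above on segments from the origin, because `φ` is continuous on the relative interior
of the face, so `log φ` is the restriction of a linear functional. Boundedness is automatic when `φ`
takes values in `[0, 1]`, hence continuity is automatic too, and the `[0, 1]`-valued points of `V_σ`
form a closed subset of a product of unit intervals, a compact set (`isCompact_setOf_le_one`).

Suppose that the fan is complete. The class of the point given by `w` and `v` depends neither on the
cone containing `w`, since all such cones share a face containing `w`, nor on `v` modulo `w`. By
completeness some cone `ρ` contains `v + n w` for infinitely many `n`, and so contains `w` by Farkas'
lemma. On the dual of `ρ` the function `exp(-(v + n w))` is at most `1`. So the toric variety is the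
finite union of the images of the compact sets of `[0, 1]`-valued points.

Conversely, suppose that `v` lies in no cone of the fan. Each `V_σ` contains the torus points
`exp(-n v)`, and each of them is glued to no other point of `V_σ` (`Fan.toricPoint_mem_torusSet`).
Farkas' lemma gives `u` in the dual of `σ` with `⟨v, u⟩ < 0`, so that `exp(-n v)` tends to infinity
at `u` and the sequence is locally finite in `V_σ`. Hence its tails are closed in the toric variety;
they are nonempty and decreasing with empty intersection, so the toric variety is not compact.
-/

namespace IrrationalToric

/-! ### Polyhedral cones, their duals and faces -/

section Cones

variable {E F : Type*} [AddCommGroup E] [Module ℝ E] [AddCommGroup F] [Module ℝ F]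

/-- **Farkas' lemma** for a finite family `g` of vectors: a vector that is nonnegative against
every functional nonnegative on the family is a nonnegative combination of it. -/
theorem exists_nonneg_combination_of_dual (p : E →ₗ[ℝ] F →ₗ[ℝ] ℝ) (hp : Function.Injective p)
    {ι : Type*} (s : Finset ι) (g : ι → E) (x : E)
    (h : ∀ u, (∀ i ∈ s, 0 ≤ p (g i) u) → 0 ≤ p x u) :
    ∃ c : ι → ℝ, (∀ i ∈ s, 0 ≤ c i) ∧ x = ∑ i ∈ s, c i • g i := by
  classical
  induction s using Finset.induction_on generalizing g x with
  | empty =>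
    refine ⟨0, by simp, hp ?_⟩
    ext u
    have h1 := h u (by simp)
    have h2 := h (-u) (by simp)
    simp only [map_neg] at h2
    simp only [Finset.sum_empty, map_zero, LinearMap.zero_apply]
    linarith
  | insert k s hk ih =>
    by_cases hc : ∀ u, (∀ i ∈ s, 0 ≤ p (g i) u) → 0 ≤ p x u
    · obtain ⟨c, hc0, hcx⟩ := ih g x hc
      refine ⟨Function.update c k 0, ?_, ?_⟩
      · intro i hi
        by_cases hik : i = k
        · simp [hik]
        · simpa [hik] using hc0 i (by simpa [hik] using hi)
      · rw [Finset.sum_insert hk, hcx]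
        simp only [Function.update_self, zero_smul, zero_add]
        refine Finset.sum_congr rfl fun i hi => ?_
        rw [Function.update_of_ne (by rintro rfl; exact hk hi)]
    · push Not at hc
      obtain ⟨z, hz, hxz⟩ := hc
      have hkz : p (g k) z < 0 := by
        by_contra hcon
        push Not at hcon
        refine absurd (h z fun i hi => ?_) (not_le.2 hxz)
        rcases Finset.mem_insert.1 hi with rfl | hi
        · exact hcon
        · exact hz i hi
      have hkz' := hkz.ne
      -- project along `g k` onto the hyperplane annihilated by `z`
      obtain ⟨c, hc0, hcx⟩ := ih (fun i => g i - (p (g i) z / p (g k) z) • g k)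
        (x - (p x z / p (g k) z) • g k) (by
          intro u hu
          have := h (u - (p (g k) u / p (g k) z) • z) (by
            intro i hi
            rcases Finset.mem_insert.1 hi with rfl | hi
            · simp [hkz']
            · have := hu i hi
              simp only [map_sub, map_smul, LinearMap.sub_apply, LinearMap.smul_apply,
                smul_eq_mul] at this ⊢
              convert this using 1
              ring)
          simp only [map_sub, map_smul, LinearMap.sub_apply, LinearMap.smul_apply,
            smul_eq_mul] at this ⊢
          convert this using 1
          ring)
      refine ⟨Function.update c k
        (p x z / p (g k) z - ∑ i ∈ s, c i * (p (g i) z / p (g k) z)), ?_, ?_⟩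
      · intro i hi
        by_cases hik : i = k
        · subst hik
          simp only [Function.update_self]
          have h1 : 0 ≤ p x z / p (g i) z := (div_pos_of_neg_of_neg hxz hkz).le
          have h2 : ∑ j ∈ s, c j * (p (g j) z / p (g i) z) ≤ 0 :=
            Finset.sum_nonpos fun j hj => mul_nonpos_of_nonneg_of_nonpos (hc0 j hj)
              (div_nonpos_of_nonneg_of_nonpos (hz j hj) hkz.le)
          linarith
        · simpa [hik] using hc0 i (by simpa [hik] using hi)
      · rw [Finset.sum_insert hk]
        have : ∑ i ∈ s, Function.update c k
            (p x z / p (g k) z - ∑ i ∈ s, c i * (p (g i) z / p (g k) z)) i • g i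
            = ∑ i ∈ s, c i • g i := by
          refine Finset.sum_congr rfl fun i hi => ?_
          rw [Function.update_of_ne (by rintro rfl; exact hk hi)]
        rw [this, Function.update_self]
        simp only [smul_sub, Finset.sum_sub_distrib, smul_smul] at hcx
        rw [sub_eq_iff_eq_add] at hcx
        rw [sub_smul, Finset.sum_smul]
        refine hcx.trans ?_
        abel

/-- Bipolar theorem for a polyhedral cone, in the direction that needs finite generation. -/
theorem mem_of_forall_mem_dual (p : E →ₗ[ℝ] F →ₗ[ℝ] ℝ) (hp : Function.Injective p)
    {σ : PointedCone ℝ E} (hσ : σ.FG) {x : E}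
    (h : ∀ u ∈ PointedCone.dual p (σ : Set E), 0 ≤ p x u) : x ∈ σ := by
  obtain ⟨s, rfl⟩ := hσ
  obtain ⟨c, hc, rfl⟩ := exists_nonneg_combination_of_dual p hp s id x fun u hu =>
    h u (by
      have : u ∈ PointedCone.dual p (s : Set E) := fun x hx => hu x hx
      rwa [← PointedCone.dual_hull] at this)
  refine Submodule.sum_mem _ fun i hi => ?_
  exact Submodule.smul_mem _ (⟨c i, hc i hi⟩ : {c : ℝ // 0 ≤ c}) (Submodule.subset_span hi)

/-- The subcone of `C` on which `x` vanishes; it is a face as soon as `x` is in the dual cone. -/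
def vanishingCone (p : E →ₗ[ℝ] F →ₗ[ℝ] ℝ) (C : PointedCone ℝ E) (x : F) : PointedCone ℝ E :=
  C ⊓ (LinearMap.ker (p.flip x)).restrictScalars {c : ℝ // 0 ≤ c}

theorem mem_vanishingCone {p : E →ₗ[ℝ] F →ₗ[ℝ] ℝ} {C : PointedCone ℝ E} {x : F} {u : E} :
    u ∈ vanishingCone p C x ↔ u ∈ C ∧ p u x = 0 := by
  simp [vanishingCone]

theorem isFace_vanishingCone {p : E →ₗ[ℝ] F →ₗ[ℝ] ℝ} {C : PointedCone ℝ E} {x : F}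
    (hx : x ∈ PointedCone.dual p (C : Set E)) : IsFace p (vanishingCone p C x) C :=
  ⟨x, hx, by ext u; exact mem_vanishingCone⟩

theorem IsFace.le {p : E →ₗ[ℝ] F →ₗ[ℝ] ℝ} {G C : PointedCone ℝ E} (h : IsFace p G C) :
    G ≤ C := by
  obtain ⟨x, -, hG⟩ := h
  intro u hu
  have : u ∈ (G : Set E) := hu
  rw [hG] at this
  exact this.1

/-- A point `u₀` of a cone such that every point of the cone is dominated by a multiple of `u₀`
lies on no proper face. -/
theorem mem_relInterior_of_absorbing {p : E →ₗ[ℝ] F →ₗ[ℝ] ℝ} {G : PointedCone ℝ E} {u₀ : E}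
    (h₀ : u₀ ∈ G) (h : ∀ u ∈ G, ∃ n : ℕ, n • u₀ - u ∈ G) : u₀ ∈ relInterior p G := by
  refine ⟨h₀, fun τ hτ hne hmem => hne (le_antisymm hτ.le fun u hu => ?_)⟩
  obtain ⟨x, hx, hτx⟩ := hτ
  have h0 : u₀ ∈ (τ : Set E) := hmem
  rw [hτx] at h0
  obtain ⟨n, hn⟩ := h u hu
  have h1 : 0 ≤ p (n • u₀ - u) x := hx hn
  have h2 : 0 ≤ p u x := hx hu
  have h3 : p u₀ x = 0 := h0.2
  simp only [map_sub, map_nsmul, LinearMap.sub_apply, LinearMap.smul_apply, h3, smul_zero,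
    zero_sub] at h1
  have : u ∈ (τ : Set E) := by
    rw [hτx]
    exact ⟨hu, by linarith⟩
  exact this

end Cones

/-! ### Additive functions on cones -/

section Additive

/-- A function that is additive on `[0, ∞)` and bounded above on `[0, 1]` is linear. -/
theorem eq_mul_of_additive_of_bddAbove {g : ℝ → ℝ} {B : ℝ}
    (hadd : ∀ s t, 0 ≤ s → 0 ≤ t → g (s + t) = g s + g t)
    (hB : ∀ t, 0 ≤ t → t ≤ 1 → g t ≤ B) {t : ℝ} (ht : 0 ≤ t) : g t = t * g 1 := by
  have hmul : ∀ s, 0 ≤ s → ∀ n : ℕ, g (n * s) = n * g s := by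
    intro s hs n
    induction n with
    | zero =>
      have := hadd 0 0 le_rfl le_rfl
      simp only [add_zero] at this
      simp only [Nat.cast_zero, zero_mul]
      linarith
    | succ n ih =>
      push_cast
      rw [add_mul, one_mul, hadd _ _ (by positivity) hs, ih]
      ring
  have hnat : ∀ n : ℕ, g n = n * g 1 := fun n => by simpa using hmul 1 zero_le_one n
  -- `s ↦ g s - s * g 1` vanishes on the natural numbers, so it is bounded above on `[0, ∞)` by its
  -- bound on `[0, 1]`; being additive, it is then nonpositive.
  have hle : ∀ s, 0 ≤ s → g s ≤ s * g 1 := by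
    intro s hs
    by_contra hcon
    push Not at hcon
    obtain ⟨n, hn⟩ := exists_nat_gt ((B + |g 1|) / (g s - s * g 1))
    rw [div_lt_iff₀ (by linarith)] at hn
    have hns : 0 ≤ (n : ℝ) * s := by positivity
    have hfl := Nat.floor_le hns
    have hlt := Nat.lt_floor_add_one ((n : ℝ) * s)
    set m := ⌊(n : ℝ) * s⌋₊
    set r := (n : ℝ) * s - m
    have h1 : g (n * s) = g m + g r := by
      rw [← hadd _ _ (by positivity) (by simp only [r]; linarith)]
      congr 1
      simp [r]
    have hr0 : 0 ≤ r := by simp only [r]; linarith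
    have hr1 : r ≤ 1 := by simp only [r]; linarith
    rw [hmul s hs, hnat] at h1
    have h2 := hB r hr0 hr1
    have h3 : -|g 1| ≤ r * g 1 := by
      have := abs_mul r (g 1)
      rw [abs_of_nonneg hr0] at this
      have h4 : r * |g 1| ≤ |g 1| := mul_le_of_le_one_left (abs_nonneg _) hr1
      have := neg_abs_le (r * g 1)
      linarith
    have h5 : (m : ℝ) = n * s - r := by simp [r]
    rw [h5] at h1
    nlinarith
  -- the values of `s ↦ g s - s * g 1` at `t` and `m - t` are nonpositive and add up to zero
  obtain ⟨m, hm⟩ := exists_nat_ge t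
  have h1 := hle t ht
  have h2 := hle (m - t) (by linarith)
  have h3 := hadd t (m - t) ht (by linarith)
  rw [add_sub_cancel, hnat] at h3
  linarith

/-- A function on a cone that is additive and positively homogeneous there extends to a linear
functional on the ambient space. -/
theorem exists_linearMap_of_additive_on_cone {E : Type*} [AddCommGroup E] [Module ℝ E]
    (C : PointedCone ℝ E) (f : E → ℝ) (hadd : ∀ u ∈ C, ∀ w ∈ C, f (u + w) = f u + f w)
    (hsmul : ∀ u ∈ C, ∀ t : ℝ, 0 ≤ t → f (t • u) = t * f u) :
    ∃ l : E →ₗ[ℝ] ℝ, ∀ u ∈ C, l u = f u := by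
  obtain ⟨b, hbC, hspan, hli⟩ := exists_linearIndependent ℝ (C : Set E)
  have hCsmul : ∀ u ∈ C, ∀ t : ℝ, 0 ≤ t → t • u ∈ C := fun u hu t ht =>
    C.smul_mem ht hu
  have hli' : LinearIndepOn ℝ id b := hli
  obtain ⟨t, e, hbt, he⟩ : ∃ (t : Set E) (e : Module.Basis t ℝ E), b ⊆ t ∧ ∀ i, e i = i :=
    ⟨_, Module.Basis.extend hli', Module.Basis.subset_extend hli',
      Module.Basis.extend_apply_self hli'⟩
  refine ⟨e.constr ℝ fun i => f i, fun u hu => ?_⟩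
  set l := e.constr ℝ fun i => f i
  have hl : ∀ x ∈ b, l x = f x := by
    intro x hx
    have := e.constr_basis ℝ (fun i => f i) ⟨x, hbt hx⟩
    rwa [he] at this
  have hf0 : f 0 = 0 := by simpa using hsmul 0 C.zero_mem 0 le_rfl
  -- on the span of the cone, `l` is the difference of values of `f` on the cone
  have key : ∀ x ∈ Submodule.span ℝ b, ∃ a ∈ C, ∃ c ∈ C, x = a - c ∧ l x = f a - f c := by
    intro x hx
    induction hx using Submodule.span_induction with
    | mem x hx => exact ⟨x, hbC hx, 0, C.zero_mem, by simp, by simp [hl x hx, hf0]⟩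
    | zero => exact ⟨0, C.zero_mem, 0, C.zero_mem, by simp, by simp⟩
    | add x y _ _ hx hy =>
      obtain ⟨a, ha, c, hc, rfl, h1⟩ := hx
      obtain ⟨a', ha', c', hc', rfl, h2⟩ := hy
      refine ⟨a + a', C.add_mem ha ha', c + c', C.add_mem hc hc', by abel, ?_⟩
      rw [map_add, h1, h2, hadd a ha a' ha', hadd c hc c' hc']
      ring
    | smul r x _ hx =>
      obtain ⟨a, ha, c, hc, rfl, h1⟩ := hx
      rcases le_total 0 r with hr | hr
      · refine ⟨r • a, hCsmul a ha r hr, r • c, hCsmul c hc r hr, smul_sub _ _ _, ?_⟩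
        rw [map_smul, h1, hsmul a ha r hr, hsmul c hc r hr, smul_eq_mul]
        ring
      · have hr' : 0 ≤ -r := by linarith
        refine ⟨(-r) • c, hCsmul c hc _ hr', (-r) • a, hCsmul a ha _ hr', ?_, ?_⟩
        · rw [smul_sub, neg_smul, neg_smul]
          abel
        · rw [map_smul, h1, hsmul a ha _ hr', hsmul c hc _ hr', smul_eq_mul]
          ring
  obtain ⟨a, ha, c, hc, hac, hla⟩ := key u (hspan ▸ Submodule.subset_span hu)
  have := hadd u hu c hc
  rw [hac, sub_add_cancel, ← hac] at this
  rw [hla]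
  linarith

end Additive

/-! ### The homomorphisms from a dual cone to `ℝ≥0` -/

section Characters

variable {N M : Type*} [AddCommGroup N] [Module ℝ N] [AddCommGroup M] [Module ℝ M]

open Classical in
/-- The function `M → ℝ≥0` that is `exp(-v)` on the hyperplane `w = 0` and zero elsewhere. For `w`
in a cone `σ` its restriction to the dual cone is a monoid homomorphism, namely the limit of the
characters `exp(-(v + t w))` as `t → ∞`. -/
noncomputable def faceExp (p : N →ₗ[ℝ] M →ₗ[ℝ] ℝ) (w v : N) (u : M) : ℝ≥0 :=
  if p w u = 0 then (Real.exp (-p v u)).toNNReal else 0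

theorem faceExp_of_eq {p : N →ₗ[ℝ] M →ₗ[ℝ] ℝ} {w : N} {u : M} (v : N) (h : p w u = 0) :
    faceExp p w v u = (Real.exp (-p v u)).toNNReal := if_pos h

theorem faceExp_of_ne {p : N →ₗ[ℝ] M →ₗ[ℝ] ℝ} {w : N} {u : M} (v : N) (h : p w u ≠ 0) :
    faceExp p w v u = 0 := if_neg h

theorem faceExp_zero_left (p : N →ₗ[ℝ] M →ₗ[ℝ] ℝ) (v : N) (u : M) :
    faceExp p 0 v u = (Real.exp (-p v u)).toNNReal := faceExp_of_eq v (by simp)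

theorem faceExp_add_smul (p : N →ₗ[ℝ] M →ₗ[ℝ] ℝ) (w v : N) (n : ℕ) :
    faceExp p w (v + n • w) = faceExp p w v := by
  ext u
  by_cases h : p w u = 0
  · simp [faceExp_of_eq _ h, h]
  · simp [faceExp_of_ne _ h]

theorem faceExp_le_one {p : N →ₗ[ℝ] M →ₗ[ℝ] ℝ} {v : N} {u : M} (w : N) (h : 0 ≤ p v u) :
    faceExp p w v u ≤ 1 := by
  by_cases hw : p w u = 0
  · rw [faceExp_of_eq _ hw, Real.toNNReal_le_one]
    exact Real.exp_le_one_iff.2 (by linarith)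
  · simp [faceExp_of_ne _ hw]

theorem faceExp_add {p : N →ₗ[ℝ] M →ₗ[ℝ] ℝ} {σ : PointedCone ℝ N} {w : N} (hw : w ∈ σ) (v : N)
    {a b : M} (ha : a ∈ PointedCone.dual p (σ : Set N)) (hb : b ∈ PointedCone.dual p (σ : Set N)) :
    faceExp p w v (a + b) = faceExp p w v a * faceExp p w v b := by
  have ha' : 0 ≤ p w a := ha hw
  have hb' : 0 ≤ p w b := hb hw
  by_cases h1 : p w a = 0
  · by_cases h2 : p w b = 0
    · rw [faceExp_of_eq _ h1, faceExp_of_eq _ h2, faceExp_of_eq _ (by simp [h1, h2]),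
        ← Real.toNNReal_mul (Real.exp_nonneg _), ← Real.exp_add]
      congr 2
      simp only [map_add]
      ring
    · rw [faceExp_of_ne _ h2, faceExp_of_ne _ (by simp [h1, h2]), mul_zero]
  · have : p w (a + b) ≠ 0 := by
      have := lt_of_le_of_ne ha' (Ne.symm h1)
      rw [map_add]
      linarith
    rw [faceExp_of_ne _ h1, faceExp_of_ne _ this, zero_mul]

section Topology

variable [FiniteDimensional ℝ M] [TopologicalSpace M] [IsTopologicalAddGroup M]
  [ContinuousSMul ℝ M] [T2Space M]

/-- The point of `V_σ` given by `faceExp p w v`, for `w` in `σ`. -/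
noncomputable def faceChar (p : N →ₗ[ℝ] M →ₗ[ℝ] ℝ) {σ : PointedCone ℝ N} (w v : N) (hw : w ∈ σ) :
    AffineVariety p σ where
  toFun u := faceExp p w v u
  map_zero := by
    rw [faceExp_of_eq _ (by simp)]
    simp
  map_add a b := faceExp_add hw v a.2 b.2
  continuousOn G hG := by
    by_cases h : ∀ u ∈ G, p w u = 0
    · have hc : Continuous fun u : M => (Real.exp (-p v u)).toNNReal :=
        continuous_real_toNNReal.comp
          (Real.continuous_exp.comp (p v).continuous_of_finiteDimensional.neg)
      exact (hc.comp continuous_subtype_val).continuousOn.congr fun u hu =>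
        faceExp_of_eq _ (h u hu.1)
    · -- `w` cuts out a proper face of `G`, so it is positive on the relative interior of `G`
      refine (continuousOn_const (c := 0)).congr fun u hu => faceExp_of_ne _ fun h0 => ?_
      refine hu.2 (vanishingCone p.flip G w) (isFace_vanishingCone fun x hx => ?_) ?_ ?_
      · exact (hG.le hx) hw
      · intro heq
        refine h fun x hx => ?_
        rw [← heq] at hx
        exact (mem_vanishingCone.1 hx).2
      · exact mem_vanishingCone.2 ⟨hu.1, h0⟩

end Topology

/-- The set where a homomorphism from a dual cone to `ℝ≥0` is nonzero is a face. Moreover this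
face has a point `u₀` that absorbs it: every point of the face is dominated by a
multiple of `u₀`. -/
theorem exists_support_eq {p : N →ₗ[ℝ] M →ₗ[ℝ] ℝ} {σ : PointedCone ℝ N} (hσ : σ.FG)
    (φ : PointedCone.dual p (σ : Set N) → ℝ≥0) (h0 : φ 0 = 1)
    (hadd : ∀ a b, φ (a + b) = φ a * φ b) :
    ∃ w ∈ σ, (∀ u, φ u ≠ 0 ↔ p w u = 0) ∧
      ∃ u₀, φ u₀ ≠ 0 ∧ ∀ u, φ u ≠ 0 → ∃ (n : ℕ) (u' : _), n • u₀ = u + u' := by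
  classical
  obtain ⟨s, rfl⟩ := hσ
  let C := PointedCone.dual p ((Submodule.span {c : ℝ // 0 ≤ c} (s : Set N) :
    PointedCone ℝ N) : Set N)
  have hmem : ∀ u : M, (∀ g ∈ s, 0 ≤ p g u) → u ∈ C := by
    intro u hu
    have : u ∈ PointedCone.dual p (s : Set N) := fun x hx => hu x hx
    rwa [← PointedCone.dual_hull] at this
  have hpos : ∀ u : C, ∀ g ∈ s, 0 ≤ p g u := fun u g hg => u.2 (Submodule.subset_span hg)
  -- `w` is the sum of the generators of `σ` that vanish on the support of `φ`
  let T := s.filter fun g => ∀ u, φ u ≠ 0 → p g (u : M) = 0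
  have hex : ∀ g : N, ∃ u : C, φ u ≠ 0 ∧ (g ∈ s → g ∉ T → 0 < p g u) := by
    intro g
    by_cases hg : g ∈ s ∧ g ∉ T
    · have : ¬ ∀ u, φ u ≠ 0 → p g (u : M) = 0 := fun h => hg.2 (Finset.mem_filter.2 ⟨hg.1, h⟩)
      push Not at this
      obtain ⟨u, hu, hne⟩ := this
      exact ⟨u, hu, fun _ _ => lt_of_le_of_ne (hpos u g hg.1) (Ne.symm hne)⟩
    · exact ⟨0, by simp [h0], fun h1 h2 => absurd ⟨h1, h2⟩ hg⟩
  choose a ha hag using hex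
  let u₀ : C := ∑ g ∈ s, a g
  have hφsum : φ u₀ ≠ 0 := by
    have : ∀ t : Finset N, φ (∑ g ∈ t, a g) = ∏ g ∈ t, φ (a g) := by
      intro t
      induction t using Finset.induction_on with
      | empty => simp [h0]
      | insert k t hk ih => rw [Finset.sum_insert hk, Finset.prod_insert hk, hadd, ih]
    rw [this]
    exact Finset.prod_ne_zero_iff.2 fun g _ => ha g
  have hu₀ : ∀ g ∈ s, g ∉ T → 0 < p g u₀ := by
    intro g hg hgT
    have h1 : p g (u₀ : M) = ∑ h ∈ s, p g (a h : M) := by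
      simp only [u₀, Submodule.coe_sum, map_sum]
    rw [h1]
    exact Finset.sum_pos' (fun h _ => hpos _ g hg) ⟨g, hg, hag g hg hgT⟩
  have habs : ∀ u : C, (∀ g ∈ T, p g (u : M) = 0) → ∃ (n : ℕ) (u' : C), n • u₀ = u + u' := by
    intro u hu
    have hev : ∀ g : N, ∃ n : ℕ, g ∈ s → g ∉ T → p g (u : M) ≤ n * p g (u₀ : M) := by
      intro g
      by_cases hg : g ∈ s ∧ g ∉ T
      · obtain ⟨n, hn⟩ := exists_nat_ge (p g (u : M) / p g (u₀ : M))
        exact ⟨n, fun h1 h2 => (div_le_iff₀ (hu₀ g h1 h2)).1 hn⟩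
      · exact ⟨0, fun h1 h2 => absurd ⟨h1, h2⟩ hg⟩
    choose n hn using hev
    have hle : ∀ g ∈ s, n g ≤ ∑ h ∈ s, n h := fun g hg =>
      Finset.single_le_sum (f := n) (fun _ _ => Nat.zero_le _) hg
    have : (∑ h ∈ s, n h) • (u₀ : M) - u ∈ C := by
      refine hmem _ fun g hg => ?_
      rw [map_sub, map_nsmul, nsmul_eq_mul]
      by_cases hgT : g ∈ T
      · rw [hu g hgT, sub_zero]
        exact mul_nonneg (Nat.cast_nonneg _) (hpos u₀ g hg)
      · have h1 := hn g hg hgT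
        have h2 : (n g : ℝ) ≤ (∑ h ∈ s, n h : ℕ) := by exact_mod_cast hle g hg
        have h3 := mul_le_mul_of_nonneg_right h2 (hpos u₀ g hg)
        linarith
    refine ⟨∑ h ∈ s, n h, ⟨_, this⟩, ?_⟩
    ext
    simp
  have hφn : ∀ n : ℕ, φ (n • u₀) ≠ 0 := by
    intro n
    induction n with
    | zero => simp [h0]
    | succ n ih =>
      rw [succ_nsmul, hadd]
      exact mul_ne_zero ih hφsum
  have hTs : ∀ g ∈ T, g ∈ s := fun g hg => (Finset.mem_filter.1 hg).1
  have hTz : ∀ g ∈ T, ∀ u, φ u ≠ 0 → p g (u : M) = 0 := fun g hg => (Finset.mem_filter.1 hg).2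
  refine ⟨∑ g ∈ T, g, Submodule.sum_mem _ fun g hg => Submodule.subset_span (hTs g hg),
    fun u => ⟨fun hu => ?_, fun hu => ?_⟩, u₀, hφsum, fun u hu => habs u fun g hg => hTz g hg u hu⟩
  · rw [map_sum, LinearMap.sum_apply]
    exact Finset.sum_eq_zero fun g hg => hTz g hg u hu
  · rw [map_sum, LinearMap.sum_apply,
      Finset.sum_eq_zero_iff_of_nonneg fun g hg => hpos u g (hTs g hg)] at hu
    obtain ⟨n, u', hn⟩ := habs u hu
    intro hφu
    apply hφn n
    rw [hn, hadd, hφu, zero_mul]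

/-- A homomorphism from a dual cone to `ℝ≥0` that is supported on the face `w = 0` and is bounded
on every segment from the origin inside that face has the form `faceExp p w v`. -/
theorem exists_eq_faceExp_of_bounded {p : N →ₗ[ℝ] M →ₗ[ℝ] ℝ} [p.IsPerfPair]
    {C : PointedCone ℝ M} (φ : C → ℝ≥0) (hadd : ∀ a b, φ (a + b) = φ a * φ b) {w : N}
    (hw : ∀ u, φ u ≠ 0 ↔ p w u = 0)
    (hb : ∀ u : C, φ u ≠ 0 → ∃ B : ℝ≥0, ∀ t : {c : ℝ // 0 ≤ c}, (t : ℝ) ≤ 1 → φ (t • u) ≤ B) :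
    ∃ v : N, ∀ u, φ u = faceExp p w v u := by
  classical
  let f : M → ℝ := fun u => if h : u ∈ C then Real.log (φ ⟨u, h⟩) else 0
  have hf : ∀ u : C, f u = Real.log (φ u) := fun u => dif_pos u.2
  let P : PointedCone ℝ M := vanishingCone p.flip C w
  have hP : ∀ u ∈ P, ∃ a : C, (a : M) = u ∧ φ a ≠ 0 := fun u hu =>
    have h := mem_vanishingCone.1 hu
    ⟨⟨u, h.1⟩, rfl, (hw _).2 h.2⟩
  have hfadd : ∀ u ∈ P, ∀ u' ∈ P, f (u + u') = f u + f u' := by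
    intro u hu u' hu'
    obtain ⟨a, rfl, ha⟩ := hP u hu
    obtain ⟨b, rfl, hb⟩ := hP u' hu'
    have := hf (a + b)
    rw [Submodule.coe_add] at this
    rw [this, hf, hf, hadd, NNReal.coe_mul, Real.log_mul (by exact_mod_cast ha)
      (by exact_mod_cast hb)]
  have hPsmul : ∀ u ∈ P, ∀ t : ℝ, 0 ≤ t → t • u ∈ P := fun u hu t ht => P.smul_mem ht hu
  have hfsmul : ∀ u ∈ P, ∀ t : ℝ, 0 ≤ t → f (t • u) = t * f u := by
    intro u hu t ht
    obtain ⟨a, rfl, ha⟩ := hP u hu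
    obtain ⟨B, hB⟩ := hb a ha
    have := eq_mul_of_additive_of_bddAbove (g := fun t => f (t • (a : M))) (B := Real.log B)
      (fun s t hs ht => by
        simp only [add_smul]
        exact hfadd _ (hPsmul _ hu s hs) _ (hPsmul _ hu t ht))
      (fun t ht ht1 => by
        have h1 := hf ((⟨t, ht⟩ : {c : ℝ // 0 ≤ c}) • a)
        have h2 : φ ((⟨t, ht⟩ : {c : ℝ // 0 ≤ c}) • a) ≠ 0 := by
          obtain ⟨b, hb, hb0⟩ := hP _ (hPsmul _ hu t ht)
          convert hb0
          exact Subtype.ext hb.symm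
        refine h1.trans_le (Real.log_le_log (by positivity) ?_)
        exact_mod_cast hB ⟨t, ht⟩ ht1) ht
    simpa using this
  obtain ⟨l, hl⟩ := exists_linearMap_of_additive_on_cone P f hfadd hfsmul
  refine ⟨-p.toPerfPair.symm l, fun u => ?_⟩
  by_cases hu : p w (u : M) = 0
  · have hne := (hw u).2 hu
    have hlu : p (p.toPerfPair.symm l) (u : M) = l u := by simp
    rw [faceExp_of_eq _ hu, map_neg, LinearMap.neg_apply, neg_neg, hlu,
      hl u (mem_vanishingCone.2 ⟨u.2, hu⟩), hf, Real.exp_log (by positivity), Real.toNNReal_coe]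
  · rw [faceExp_of_ne _ hu]
    by_contra h
    exact hu ((hw u).1 h)

/-- A homomorphism from a dual cone to `[0, 1]` is automatically of the form `faceExp p w v`. -/
theorem exists_eq_faceExp_of_le_one {p : N →ₗ[ℝ] M →ₗ[ℝ] ℝ} [p.IsPerfPair] {σ : PointedCone ℝ N}
    (hσ : σ.FG) (φ : PointedCone.dual p (σ : Set N) → ℝ≥0) (h0 : φ 0 = 1)
    (hadd : ∀ a b, φ (a + b) = φ a * φ b) (hle : ∀ u, φ u ≤ 1) :
    ∃ w ∈ σ, ∃ v, ∀ u, φ u = faceExp p w v u := by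
  obtain ⟨w, hw, hsupp, -⟩ := exists_support_eq hσ φ h0 hadd
  exact ⟨w, hw, exists_eq_faceExp_of_bounded φ hadd hsupp fun u _ => ⟨1, fun t _ => hle _⟩⟩

/-- Every point of `V_σ` is of the form `faceExp p w v` with `w` in `σ`. -/
theorem exists_eq_faceExp {p : N →ₗ[ℝ] M →ₗ[ℝ] ℝ} [p.IsPerfPair] [TopologicalSpace M]
    [IsTopologicalAddGroup M] [ContinuousSMul ℝ M] {σ : PointedCone ℝ N} (hσ : σ.FG)
    (φ : AffineVariety p σ) : ∃ w ∈ σ, ∃ v, ∀ u, φ.toFun u = faceExp p w v u := by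
  obtain ⟨w, hw, hsupp, u₀, hu₀, habs⟩ := exists_support_eq hσ φ.toFun φ.map_zero φ.map_add
  refine ⟨w, hw, exists_eq_faceExp_of_bounded _ φ.map_add hsupp fun u hu => ?_⟩
  let C := PointedCone.dual p (σ : Set N)
  let G : PointedCone ℝ M := vanishingCone p.flip C w
  have hGmem : ∀ x : C, (x : M) ∈ G ↔ φ.toFun x ≠ 0 := fun x =>
    mem_vanishingCone.trans ((and_iff_right x.2).trans (hsupp x).symm)
  -- The ray `u₀ + t u` stays in the relative interior of `G`, so `φ` is continuous along it.
  let r : unitInterval → C := fun t => u₀ + (⟨t, t.2.1⟩ : {c : ℝ // 0 ≤ c}) • u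
  have hr : Continuous r := by
    refine Continuous.subtype_mk (f := fun t : unitInterval => (u₀ : M) + (t : ℝ) • (u : M)) ?_ _
    fun_prop
  have hrel : ∀ t, ((r t : C) : M) ∈ relInterior p.flip G := by
    intro t
    have htu : (t : ℝ) • (u : M) ∈ G := G.smul_mem t.2.1 ((hGmem u).2 hu)
    refine mem_relInterior_of_absorbing (G.add_mem ((hGmem u₀).2 hu₀) htu) fun x hx => ?_
    have hxC : x ∈ C := (mem_vanishingCone.1 hx).1
    obtain ⟨n, u', hn⟩ := habs ⟨x, hxC⟩ ((hGmem ⟨x, hxC⟩).1 hx)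
    refine ⟨n, ?_⟩
    have hn' : n • (u₀ : M) = x + u' := by simpa using congrArg Subtype.val hn
    have hu' : (u' : M) ∈ G := by
      refine mem_vanishingCone.2 ⟨u'.2, ?_⟩
      have h1 := congrArg (p w) hn'
      have h2 : p w (u₀ : M) = 0 := (hsupp u₀).1 hu₀
      have h3 : p w x = 0 := (mem_vanishingCone.1 hx).2
      rw [map_nsmul, map_add, h2, h3, smul_zero, zero_add] at h1
      exact h1.symm
    have : n • ((u₀ : M) + (t : ℝ) • (u : M)) - x = u' + n • ((t : ℝ) • (u : M)) := by
      rw [smul_add, hn']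
      abel
    have h4 : n • ((t : ℝ) • (u : M)) ∈ G := G.nsmul_mem htu n
    have h5 := G.add_mem hu' h4
    rw [← this] at h5
    exact h5
  have hcont : Continuous fun t => φ.toFun (r t) :=
    (φ.continuousOn G (isFace_vanishingCone fun x hx => hx hw)).comp_continuous hr hrel
  obtain ⟨B, hB⟩ := (isCompact_range hcont).bddAbove
  refine ⟨B / φ.toFun u₀, fun t ht => ?_⟩
  rw [le_div_iff₀ (pos_iff_ne_zero.2 hu₀), mul_comm, ← φ.map_add]
  exact hB ⟨⟨t, t.2, ht⟩, rfl⟩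

end Characters

/-! ### Fans and rays -/

section Fans

variable {N M : Type*} [AddCommGroup N] [Module ℝ N] [AddCommGroup M] [Module ℝ M]
  {p : N →ₗ[ℝ] M →ₗ[ℝ] ℝ}

/-- Every point of a fan's support lies in a cone of the fan that is a face of every cone of the
fan containing the point. -/
theorem Fan.exists_minimal_cone (S : Fan p) {σ : PointedCone ℝ N} (hσ : σ ∈ S.cones) {w : N}
    (hw : w ∈ σ) : ∃ τ ∈ S.cones, w ∈ τ ∧ ∀ ρ ∈ S.cones, w ∈ ρ → IsFace p τ ρ := by
  have hfin : {τ | τ ∈ S.cones ∧ w ∈ τ}.Finite := S.finite.subset fun τ h => h.1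
  obtain ⟨τ, hτ⟩ := hfin.exists_minimal ⟨σ, hσ, hw⟩
  refine ⟨τ, hτ.1.1, hτ.1.2, fun ρ hρ hwρ => ?_⟩
  obtain ⟨h1, h2⟩ := S.inter_face τ hτ.1.1 ρ hρ
  have : τ ⊓ ρ = τ := le_antisymm inf_le_left
    (hτ.2 ⟨S.face_mem τ hτ.1.1 _ h1, hτ.1.2, hwρ⟩ inf_le_left)
  rwa [this] at h2

/-- Some cone of a complete fan contains `v + n w` for infinitely many `n`, and since polyhedral
cones are closed such a cone contains `w`. -/
theorem Fan.IsComplete.exists_cone_of_ray {S : Fan p} (hp : Function.Injective p)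
    (hS : S.IsComplete) (v w : N) : ∃ ρ ∈ S.cones, w ∈ ρ ∧ ∃ n : ℕ, v + n • w ∈ ρ := by
  have : Finite S.cones := S.finite
  choose c hc hcv using fun n : ℕ => hS (v + n • w)
  obtain ⟨ρ, hρ⟩ := Finite.exists_infinite_fiber fun n : ℕ => (⟨c n, hc n⟩ : S.cones)
  rw [Set.infinite_coe_iff] at hρ
  have hmem : ∀ n ∈ (fun n : ℕ => (⟨c n, hc n⟩ : S.cones)) ⁻¹' {ρ}, v + n • w ∈ ρ.1 := by
    rintro n rfl
    exact hcv n
  refine ⟨ρ, ρ.2, mem_of_forall_mem_dual p hp (S.polyhedral ρ ρ.2) fun u hu => ?_, ?_⟩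
  · by_contra hneg
    push Not at hneg
    obtain ⟨m, hm⟩ := exists_nat_gt (p v u / -p w u)
    obtain ⟨n, hn, hmn⟩ := hρ.exists_gt m
    have h1 : 0 ≤ p (v + n • w) u := hu (hmem n hn)
    rw [div_lt_iff₀ (by linarith)] at hm
    have h2 : (m : ℝ) ≤ n := by exact_mod_cast hmn.le
    simp only [map_add, map_nsmul, LinearMap.add_apply, LinearMap.smul_apply, nsmul_eq_mul] at h1
    nlinarith
  · obtain ⟨n, hn⟩ := hρ.nonempty
    exact ⟨n, hmem n hn⟩

/-- Along a ray outside `σ`, the characters `exp(-n v)` leave every neighbourhood of each point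
of `V_σ`. -/
theorem exists_exp_tendsto_of_notMem (hp : Function.Injective p) {σ : PointedCone ℝ N}
    (hσ : σ.FG) {v : N} (hv : v ∉ σ) : ∃ u : PointedCone.dual p (σ : Set N),
      Filter.Tendsto (fun n : ℕ => faceExp p 0 (n • v) (u : M)) Filter.atTop Filter.atTop := by
  have : ¬ ∀ u ∈ PointedCone.dual p (σ : Set N), 0 ≤ p v u := fun h =>
    hv (mem_of_forall_mem_dual p hp hσ h)
  push Not at this
  obtain ⟨u, hu, hneg⟩ := this
  refine ⟨⟨u, hu⟩, ?_⟩
  simp only [faceExp_zero_left, map_nsmul, LinearMap.smul_apply, nsmul_eq_mul]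
  refine Real.tendsto_toNNReal_atTop.comp (Real.tendsto_exp_atTop.comp ?_)
  simp only [← mul_neg]
  exact Filter.Tendsto.atTop_mul_const (by linarith) tendsto_natCast_atTop_atTop

end Fans

/-! ### Compactness of the toric variety -/

section Variety

variable {N M : Type*} [AddCommGroup N] [Module ℝ N] [AddCommGroup M] [Module ℝ M]
  [TopologicalSpace M] {p : N →ₗ[ℝ] M →ₗ[ℝ] ℝ}

/-- Points of `V_σ` are determined by their values, so `V_σ` embeds in a product. -/
theorem isEmbedding_toFun (σ : PointedCone ℝ N) :
    Topology.IsEmbedding (HomC.toFun : AffineVariety p σ → _) :=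
  ⟨⟨rfl⟩, fun _ _ h => HomC.ext h⟩

/-- The points of `V_σ` with values in `[0, 1]` form a compact set: continuity on relative
interiors of faces is automatic for them, so they form a closed subset of a product of copies of
`[0, 1]`. -/
theorem isCompact_setOf_le_one [FiniteDimensional ℝ M] [IsTopologicalAddGroup M]
    [ContinuousSMul ℝ M] [T2Space M] [p.IsPerfPair] {σ : PointedCone ℝ N} (hσ : σ.FG) :
    IsCompact {φ : AffineVariety p σ | ∀ u, φ.toFun u ≤ 1} := by
  rw [(isEmbedding_toFun σ).isCompact_iff]
  let C := PointedCone.dual p (σ : Set N)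
  let K : Set (C → ℝ≥0) := {f | f 0 = 1 ∧ (∀ a b, f (a + b) = f a * f b) ∧ ∀ u, f u ≤ 1}
  have himage : HomC.toFun '' {φ : AffineVariety p σ | ∀ u, φ.toFun u ≤ 1} = K := by
    ext f
    constructor
    · rintro ⟨φ, hφ, rfl⟩
      exact ⟨φ.map_zero, φ.map_add, hφ⟩
    · rintro ⟨h0, hadd, hle⟩
      obtain ⟨w, hw, v, hv⟩ := exists_eq_faceExp_of_le_one hσ f h0 hadd hle
      have hf : (faceChar p w v hw : AffineVariety p σ).toFun = f := funext fun u => (hv u).symm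
      exact ⟨faceChar p w v hw, fun u => by rw [hf]; exact hle u, hf⟩
  rw [himage]
  have hcube : IsCompact (Set.univ.pi fun _ : C => Set.Icc (0 : ℝ≥0) 1) :=
    isCompact_univ_pi fun _ => isCompact_Icc
  refine hcube.of_isClosed_subset ?_ fun f hf u _ => ⟨zero_le, hf.2.2 u⟩
  refine IsClosed.and (isClosed_eq (continuous_apply _) continuous_const) (IsClosed.and ?_ ?_)
  · simp only [Set.ofPred_forall]
    exact isClosed_iInter fun a => isClosed_iInter fun b =>
      isClosed_eq (continuous_apply _) ((continuous_apply a).mul (continuous_apply b))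
  · simp only [Set.ofPred_forall]
    exact isClosed_iInter fun a => isClosed_le (continuous_apply _) continuous_const

/-- The image in the toric variety of a point of `V_σ`. -/
def Fan.toricPoint (S : Fan p) (σ : S.cones) (φ : AffineVariety p σ.1) : S.ToricVariety :=
  Quot.mk S.Glue ⟨σ, φ⟩

theorem Fan.continuous_toricPoint (S : Fan p) (σ : S.cones) : Continuous (S.toricPoint σ) :=
  continuous_quot_mk.comp continuous_sigmaMk

variable [FiniteDimensional ℝ M] [IsTopologicalAddGroup M] [ContinuousSMul ℝ M] [T2Space M]

/-- The class of `faceExp p w v` does not depend on the cone containing `w`. -/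
theorem Fan.toricPoint_faceChar_eq (S : Fan p) (σ ρ : S.cones) {w : N} (v : N) (hσ : w ∈ σ.1)
    (hρ : w ∈ ρ.1) : S.toricPoint σ (faceChar p w v hσ) = S.toricPoint ρ (faceChar p w v hρ) := by
  obtain ⟨τ, hτ, hwτ, hface⟩ := S.exists_minimal_cone σ.2 hσ
  have key : ∀ (ρ : S.cones) (hρ : w ∈ ρ.1),
      S.toricPoint ⟨τ, hτ⟩ (faceChar p w v hwτ) = S.toricPoint ρ (faceChar p w v hρ) := fun ρ hρ =>
    Quot.sound ⟨hface ρ ρ.2 hρ, fun _ _ _ => rfl⟩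
  rw [← key σ hσ, ← key ρ hρ]

/-- The toric variety of a complete fan is the union of the compact images of the sets of
`[0, 1]`-valued points. -/
theorem Fan.compactSpace_of_isComplete [p.IsPerfPair] (S : Fan p) (hS : S.IsComplete) :
    CompactSpace S.ToricVariety := by
  have hfin : Finite S.cones := S.finite
  have hp : Function.Injective p := (LinearMap.IsPerfPair.bijective_left p).1
  have hK : IsCompact (⋃ σ : S.cones, S.toricPoint σ '' {φ | ∀ u, φ.toFun u ≤ 1}) :=
    isCompact_iUnion fun σ =>
      (isCompact_setOf_le_one (S.polyhedral σ σ.2)).image (S.continuous_toricPoint σ)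
  refine ⟨?_⟩
  convert hK
  refine (Set.eq_univ_of_forall fun y => ?_).symm
  obtain ⟨⟨σ, φ⟩, rfl⟩ := Quot.exists_rep y
  obtain ⟨w, hw, v, hφ⟩ := exists_eq_faceExp (S.polyhedral σ σ.2) φ
  obtain rfl : φ = faceChar p w v hw := HomC.ext (funext hφ)
  obtain ⟨ρ, hρ, hwρ, n, hn⟩ := hS.exists_cone_of_ray hp v w
  refine Set.mem_iUnion.2 ⟨⟨ρ, hρ⟩, faceChar p w v hwρ, fun u => ?_,
    S.toricPoint_faceChar_eq ⟨ρ, hρ⟩ σ v hwρ hw⟩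
  change faceExp p w v u ≤ 1
  rw [← faceExp_add_smul p w v n]
  exact faceExp_le_one w (u.2 hn)

/-- The torus point `exp(-v)` of the toric variety of a fan, as a set: the classes of the
restrictions of `exp(-v)` to the dual cones, which all coincide. -/
def Fan.torusSet (S : Fan p) (v : N) : Set S.ToricVariety :=
  {y | ∃ σ : S.cones, y = S.toricPoint σ (faceChar p 0 v σ.1.zero_mem)}

/-- A character `exp(-v)` of the dual of a cone has only one extension to the dual of a face. -/
theorem eq_faceChar_zero_of_restricts {τ σ : PointedCone ℝ N} (hσ : σ.FG) (hface : IsFace p τ σ)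
    {v : N} {φ : AffineVariety p τ} (h : Restricts φ (faceChar p 0 v σ.zero_mem)) :
    φ = faceChar p 0 v τ.zero_mem := by
  classical
  have hanti : ∀ u ∈ PointedCone.dual p (σ : Set N), u ∈ PointedCone.dual p (τ : Set N) :=
    fun u hu => PointedCone.dual_anti hface.le hu
  obtain ⟨x, hx, hτ⟩ := hface
  obtain ⟨s, rfl⟩ := hσ
  refine HomC.ext (funext fun u => ?_)
  -- adding a large multiple of `x` moves `u` into the smaller dual cone
  obtain ⟨n, hn⟩ : ∃ n : ℕ, (u : M) + n • x ∈ PointedCone.dual p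
      ((Submodule.span {c : ℝ // 0 ≤ c} (s : Set N) : PointedCone ℝ N) : Set N) := by
    have hpos : ∀ g ∈ s, 0 ≤ p g x := fun g hg => hx (Submodule.subset_span hg)
    have hev : ∀ g : N, ∃ n : ℕ, g ∈ s → ∀ m : ℕ, n ≤ m → 0 ≤ p g (u : M) + m * p g x := by
      intro g
      by_cases hg : g ∈ s
      · rcases (hpos g hg).eq_or_lt with h0 | h0
        · refine ⟨0, fun _ m _ => ?_⟩
          have : g ∈ (τ : Set N) := by
            rw [hτ]
            exact ⟨Submodule.subset_span hg, h0.symm⟩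
          rw [← h0, mul_zero, add_zero]
          exact u.2 this
        · obtain ⟨n, hn⟩ := exists_nat_ge (-p g (u : M) / p g x)
          refine ⟨n, fun _ m hm => ?_⟩
          rw [div_le_iff₀ h0] at hn
          have : (n : ℝ) * p g x ≤ m * p g x :=
            mul_le_mul_of_nonneg_right (by exact_mod_cast hm) h0.le
          linarith
      · exact ⟨0, fun h => absurd h hg⟩
    choose n hn using hev
    refine ⟨∑ g ∈ s, n g, ?_⟩
    have : (u : M) + (∑ g ∈ s, n g) • x ∈ PointedCone.dual p (s : Set N) := by
      intro g hg
      have := hn g hg (∑ g ∈ s, n g)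
        (Finset.single_le_sum (f := n) (fun _ _ => Nat.zero_le _) hg)
      simpa [nsmul_eq_mul] using this
    rwa [← PointedCone.dual_hull] at this
  have hnx := nsmul_mem hx n
  have hval : ∀ a (ha : a ∈ PointedCone.dual p
      ((Submodule.span {c : ℝ // 0 ≤ c} (s : Set N) : PointedCone ℝ N) : Set N)),
      φ.toFun ⟨a, hanti a ha⟩ = faceExp p 0 v a := fun a ha => (h a ha (hanti a ha)).symm
  have h1 := φ.map_add u ⟨n • x, hanti _ hnx⟩
  have h2 := faceExp_add τ.zero_mem v u.2 (hanti _ hnx)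
  rw [hval _ hnx] at h1
  have h3 : φ.toFun (u + ⟨n • x, hanti _ hnx⟩) = faceExp p 0 v (u + n • x) := hval _ hn
  rw [h3, h2] at h1
  refine (mul_right_cancel₀ ?_ h1).symm
  rw [faceExp_zero_left]
  exact (Real.toNNReal_pos.2 (Real.exp_pos _)).ne'

/-- The only point of `V_σ` glued to the torus point `exp(-v)` is `exp(-v)` itself. -/
theorem Fan.toricPoint_mem_torusSet (S : Fan p) {v : N} {σ : S.cones} {φ : AffineVariety p σ.1} :
    S.toricPoint σ φ ∈ S.torusSet v ↔ φ = faceChar p 0 v σ.1.zero_mem := by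
  refine ⟨?_, fun h => ⟨σ, by rw [h]⟩⟩
  -- being represented by `exp(-v)` is invariant under the gluing relation
  let P : S.ToricVariety → Prop := Quot.lift
    (fun x : Σ σ : S.cones, AffineVariety p σ.1 => x.2 = faceChar p 0 v x.1.1.zero_mem) (by
      rintro ⟨τ, φ⟩ ⟨σ, ψ⟩ ⟨hface, hres⟩
      refine propext ⟨fun h => ?_, fun h => ?_⟩
      · dsimp only at h hres hface ⊢
        rw [h] at hres
        exact HomC.ext (funext fun u => hres u u.2 (PointedCone.dual_anti hface.le u.2))
      · dsimp only at h hres hface ⊢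
        rw [h] at hres
        exact eq_faceChar_zero_of_restricts (S.polyhedral σ σ.2) hface hres)
  rintro ⟨ρ, hρ⟩
  have : P (S.toricPoint ρ (faceChar p 0 v ρ.1.zero_mem)) := rfl
  rw [← hρ] at this
  exact this

/-- If `v` is outside the support of the fan then every tail of the sequence `exp(-n v)` is
closed in the toric variety. -/
theorem Fan.isClosed_iUnion_torusSet (S : Fan p) (hp : Function.Injective p) {v : N}
    (hv : ∀ σ ∈ S.cones, v ∉ σ) (k : ℕ) : IsClosed (⋃ n ≥ k, S.torusSet (n • v)) := by
  refine (isQuotientMap_quot_mk (r := S.Glue)).isClosed_preimage.1 (isClosed_sigma_iff.2 ?_)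
  intro σ
  have hpre : S.toricPoint σ ⁻¹' (⋃ n ≥ k, S.torusSet (n • v)) =
      ⋃ n : Set.Ici k, {(faceChar p 0 ((n : ℕ) • v) σ.1.zero_mem : AffineVariety p σ.1)} := by
    ext φ
    simp only [Set.mem_preimage, Set.mem_iUnion, Set.mem_singleton_iff, Subtype.exists,
      Set.mem_Ici, exists_prop, S.toricPoint_mem_torusSet]
  change IsClosed (S.toricPoint σ ⁻¹' (⋃ n ≥ k, S.torusSet (n • v)))
  rw [hpre]
  have : T1Space (AffineVariety p σ.1) := (isEmbedding_toFun σ.1).t1Space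
  obtain ⟨u, hu⟩ := exists_exp_tendsto_of_notMem hp (S.polyhedral σ σ.2) (hv σ σ.2)
  refine LocallyFinite.isClosed_iUnion (fun φ => ?_) fun _ => isClosed_singleton
  have hcont : Continuous fun ψ : AffineVariety p σ.1 => ψ.toFun u :=
    (continuous_apply u).comp (isEmbedding_toFun σ.1).continuous
  refine ⟨{ψ | ψ.toFun u < φ.toFun u + 1},
    (isOpen_lt hcont continuous_const).mem_nhds (lt_add_one (φ.toFun u)), ?_⟩
  obtain ⟨m, hm⟩ := Filter.eventually_atTop.1 (hu.eventually_ge_atTop (φ.toFun u + 1))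
  refine ((Set.finite_lt_nat m).preimage Subtype.val_injective.injOn).subset ?_
  rintro n ⟨_, rfl, hψ⟩
  by_contra hn
  exact absurd hψ (not_lt.2 (hm n (not_lt.1 hn)))

/-- If the support of the fan misses `v`, the sequence of torus points `exp(-n v)` has closed
tails with empty intersection. -/
theorem Fan.isComplete_of_compactSpace [p.IsPerfPair] (S : Fan p)
    [CompactSpace S.ToricVariety] : S.IsComplete := by
  have hp : Function.Injective p := (LinearMap.IsPerfPair.bijective_left p).1
  intro v
  by_contra! hv
  obtain ⟨σ₀, hσ₀⟩ := S.nonempty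
  have hcl := S.isClosed_iUnion_torusSet hp hv
  obtain ⟨y, hy⟩ := IsCompact.nonempty_iInter_of_sequence_nonempty_isCompact_isClosed
    (fun k => ⋃ n ≥ k, S.torusSet (n • v))
    (fun k => Set.biUnion_subset_biUnion_left fun n (hn : k + 1 ≤ n) => (Nat.le_succ k).trans hn)
    (fun k => ⟨_, Set.mem_biUnion (le_refl k) ⟨⟨σ₀, hσ₀⟩, rfl⟩⟩)
    (hcl 0).isCompact hcl
  obtain ⟨⟨σ, φ⟩, rfl⟩ := Quot.exists_rep y
  obtain ⟨u, hu⟩ := exists_exp_tendsto_of_notMem hp (S.polyhedral σ σ.2) (hv σ σ.2)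
  obtain ⟨m, hm⟩ := Filter.eventually_atTop.1 (hu.eventually_gt_atTop (φ.toFun u))
  obtain ⟨n, hn, hmem⟩ := Set.mem_iUnion₂.1 (Set.mem_iInter.1 hy m)
  have hφ := S.toricPoint_mem_torusSet.1 hmem
  have hlt := hm n hn
  rw [hφ] at hlt
  exact lt_irrefl _ hlt

end Variety

end IrrationalToric

/-- `N` and `M` are dual finite-dimensional real vector spaces, with perfect pairing `p`, and `M`
carries its usual topology (the only Hausdorff vector space topology). -/
theorem mainTheorem3 {N M : Type*} [AddCommGroup N] [Module ℝ N] [FiniteDimensional ℝ N]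
    [AddCommGroup M] [Module ℝ M] [FiniteDimensional ℝ M]
    [TopologicalSpace M] [IsTopologicalAddGroup M] [ContinuousSMul ℝ M] [T2Space M]
    (p : N →ₗ[ℝ] M →ₗ[ℝ] ℝ) [p.IsPerfPair] (S : IrrationalToric.Fan p) :
    CompactSpace S.ToricVariety ↔ S.IsComplete :=
  ⟨fun _ => S.isComplete_of_compactSpace, S.compactSpace_of_isComplete⟩
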